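/- For a positive integer $a$ and a prime $p$ let $H(a)=\sum_{k=1}^{p-1}\frac{1}{k^a}\in\mathbb{Q}$. For rational numbers $x,y$, write $x\equiv y \pmod{p^n}$ if $x-y=p^n c$ for some rational number $c$ whose reduced denominator is not divisible by $p$. For every prime $p>5$, $$\sum_{k=1}^{p-1}\frac{(-1)^k}{k^2}\binom{2k}{k}\equiv\frac45\left(\frac{H(1)}{p}+2p\,H(3)\right)\pmod{p^4}.$$ -/

import Mathlib

/-- The (depth one) harmonic sum `H(a; n) = ∑_{k=1}^{n} 1 / k^a`, a rational number. -/
def harmonicSum (a n : ℕ) : ℚ :=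
  ∑ k ∈ Finset.Icc 1 n, 1 / (k : ℚ) ^ a

/-- Congruence of rational numbers modulo the prime power `p ^ n`: the difference is
`p ^ n` times a `p`-integral rational, that is, a rational whose reduced denominator is
not divisible by `p`. -/
def RatModEq (p n : ℕ) (x y : ℚ) : Prop :=
  ∃ c : ℚ, ¬ p ∣ c.den ∧ x - y = (p : ℚ) ^ n * c

/-!
The congruence comes from an exact identity in which the prime enters only through its fourth
power. For every `n ≥ 1`,

`(5/2) ∑_{k=1}^n binom(2k, k) k² / (k⁴ + 4n⁴) ∏_{m<k} (n⁴ - m⁴) / (m⁴ + 4n⁴) = 1 / n²`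

(`sum_centralBinom_mul_prod_div`). At `n = p` the terms with `k < p` are
`(-1)^(k-1) binom(2k, k) / k²` modulo `p⁴`, and the term `k = p` is
`(binom(2p, p) / 2) ∏_{m<p} (p⁴ - m⁴) / (m⁴ + 4p⁴) / p²`. So the alternating sum is determined
modulo `p⁴` as soon as `binom(2p, p)` and the last product are known modulo `p⁶`.

The identity is not accessible to creative telescoping in `n`, because a shift of `n` moves the
roots `n (±1 ± i)` of `k⁴ + 4n⁴` by nonintegers. It is the case `a = n²` of an identity with
`k⁴ + 4n⁴` replaced by `((k - n)² + a) ((k + n)² + a)`, where `a` is free. With `a` fixed, a shift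
of `n` is harmless, and the normalized summand has a Wilf–Zeilberger companion
(`aperyTerm_add_one_sub`); summing over `n` gives the closed form (`sum_aperyTerm`).

For the arithmetic part put `u_k = 1 / (k (p - k))`, so that `1/k + 1/(p - k) = p u_k`. Every
quantity is expressed by the power sums of the `u_k`: the harmonic sums through the symmetric
functions of `1/k` and `1/(p - k)`, and `binom(2p, p) / 2 = ∏_{k<p} (1 + p/k)` through its square
`∏ (1 + 2 p² u_k)`. As `∑ u_k` is divisible by `p` (`exists_sum_pairInv_eq`, from the vanishing of
`∑ 1/k²` modulo `p`), this gives `binom(2p, p) / 2 ≡ 1 + p² ∑ u_k - p⁴ ∑ u_k²` modulo `p⁶`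
(`exists_centralBinom_eq`), while the last product is `1 - 5 p⁴ ∑ u_k²` modulo `p⁶`
(`exists_prod_quotient_eq`). Both sides of the congruence become
`(2/5) ∑ u_k - (12/5) p² ∑ u_k²` modulo `p⁴`; that `5` is a unit is where `p > 5` is needed.
-/

/-! ### A finite Apéry-like identity in two parameters -/

/-- The factor `binom(2k, k) ∏_{m<k} (m² + a)` of the summand, with `k = j + 1`. -/
def aperyCoeff (a : ℚ) (j : ℕ) : ℚ :=
  (Nat.centralBinom (j + 1) : ℚ) * ∏ i ∈ Finset.range j, (((i : ℚ) + 1) ^ 2 + a)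

/-- The product `∏_{m=1}^{j} (x² - m²)`. -/
def numProd (x : ℚ) (j : ℕ) : ℚ :=
  ∏ i ∈ Finset.range j, (x ^ 2 - ((i : ℚ) + 1) ^ 2)

/-- The product `∏_{m=1}^{k} ((m - x)² + a) ((m + x)² + a)`. -/
def denProd (a x : ℚ) (k : ℕ) : ℚ :=
  ∏ i ∈ Finset.range k, (((i : ℚ) + 1 - x) ^ 2 + a) * (((i : ℚ) + 1 + x) ^ 2 + a)

/-- The product of `y` over the `2j` points `y = x - j + 1, …, x + j`; up to a linear factor it is
both `x * numProd x j` and `(x + 1) * numProd (x + 1) j`. -/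
def numWindow (x : ℚ) (j : ℕ) : ℚ :=
  ∏ i ∈ Finset.range j, (x - i) * (x + i + 1)

/-- The product of `y² + a` over the `2k` points `y = x - k + 1, …, x + k`; up to a quadratic
factor it is both `(x² + a) * denProd a x k` and `((x + 1)² + a) * denProd a (x + 1) k`. -/
def denWindow (a x : ℚ) (k : ℕ) : ℚ :=
  ∏ i ∈ Finset.range k, ((x - i) ^ 2 + a) * ((x + i + 1) ^ 2 + a)

/-- The `k = j + 1` summand of the two-parameter identity, multiplied by `x² / (x² + a)`. This
normalization makes the summand half of a Wilf–Zeilberger pair. -/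
def aperyTerm (a x : ℚ) (j : ℕ) : ℚ :=
  aperyCoeff a j * (5 * ((j : ℚ) + 1) ^ 2 - x ^ 2 + a) * x ^ 2 * numProd x j /
    ((x ^ 2 + a) * denProd a x (j + 1))

/-- The Wilf–Zeilberger companion of `aperyTerm`. -/
def aperyMate (a x : ℚ) (j : ℕ) : ℚ :=
  -((2 * x + 1) * ((j : ℚ) + 1) * aperyCoeff a j * numWindow x j / denWindow a x (j + 1))

theorem aperyCoeff_succ (a : ℚ) (j : ℕ) :
    ((j : ℚ) + 2) * aperyCoeff a (j + 1) =
      2 * (2 * (j : ℚ) + 3) * (((j : ℚ) + 1) ^ 2 + a) * aperyCoeff a j := by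
  have h : ((j : ℚ) + 1 + 1) * (Nat.centralBinom (j + 1 + 1) : ℚ) =
      2 * (2 * ((j : ℚ) + 1) + 1) * (Nat.centralBinom (j + 1) : ℚ) := by
    exact_mod_cast Nat.succ_mul_centralBinom_succ (j + 1)
  unfold aperyCoeff
  rw [Finset.prod_range_succ]
  linear_combination (∏ i ∈ Finset.range j, (((i : ℚ) + 1) ^ 2 + a)) * (((j : ℚ) + 1) ^ 2 + a) * h

theorem mul_numProd (x : ℚ) (j : ℕ) : x * numProd x j = (x - j) * numWindow x j := by
  induction j with
  | zero => simp [numProd, numWindow]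
  | succ j ih =>
    rw [numProd, numWindow, Finset.prod_range_succ, Finset.prod_range_succ, ← numProd, ← numWindow]
    push_cast
    linear_combination (x ^ 2 - ((j : ℚ) + 1) ^ 2) * ih

theorem add_one_mul_numProd (x : ℚ) (j : ℕ) :
    (x + 1) * numProd (x + 1) j = (x + j + 1) * numWindow x j := by
  induction j with
  | zero => simp [numProd, numWindow]
  | succ j ih =>
    rw [numProd, numWindow, Finset.prod_range_succ, Finset.prod_range_succ, ← numProd, ← numWindow]
    push_cast
    linear_combination ((x + 1) ^ 2 - ((j : ℚ) + 1) ^ 2) * ih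

theorem mul_denProd (a x : ℚ) (k : ℕ) :
    (x ^ 2 + a) * denProd a x k = ((x - k) ^ 2 + a) * denWindow a x k := by
  induction k with
  | zero => simp [denProd, denWindow]
  | succ k ih =>
    rw [denProd, denWindow, Finset.prod_range_succ, Finset.prod_range_succ, ← denProd, ← denWindow]
    push_cast
    linear_combination ((((k : ℚ) + 1 - x) ^ 2 + a) * (((k : ℚ) + 1 + x) ^ 2 + a)) * ih

theorem add_one_mul_denProd (a x : ℚ) (k : ℕ) :
    ((x + 1) ^ 2 + a) * denProd a (x + 1) k = ((x + k + 1) ^ 2 + a) * denWindow a x k := by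
  induction k with
  | zero => simp [denProd, denWindow]
  | succ k ih =>
    rw [denProd, denWindow, Finset.prod_range_succ, Finset.prod_range_succ, ← denProd, ← denWindow]
    push_cast
    linear_combination
      ((((k : ℚ) + 1 - (x + 1)) ^ 2 + a) * (((k : ℚ) + 1 + (x + 1)) ^ 2 + a)) * ih

theorem denWindow_pos {a : ℚ} (ha : 0 < a) (x : ℚ) (k : ℕ) : 0 < denWindow a x k :=
  Finset.prod_pos fun i _ => by positivity

/-- The Wilf–Zeilberger equation. All four terms are rational multiples of
`aperyCoeff a j * numWindow x j / denWindow a x (j + 1)`, which leaves an identity of polynomials. -/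
theorem aperyTerm_add_one_sub {a : ℚ} (ha : 0 < a) (x : ℚ) (j : ℕ) :
    aperyTerm a (x + 1) j - aperyTerm a x j = aperyMate a x (j + 1) - aperyMate a x j := by
  have hV : denWindow a x (j + 1) ≠ 0 := (denWindow_pos ha x _).ne'
  have h1 : (x - ((j : ℚ) + 1)) ^ 2 + a ≠ 0 := by positivity
  have h2 : (x + ((j : ℚ) + 1) + 1) ^ 2 + a ≠ 0 := by positivity
  have e1 : aperyTerm a x j = aperyCoeff a j * (5 * ((j : ℚ) + 1) ^ 2 - x ^ 2 + a) * x *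
      ((x - j) * numWindow x j) / (((x - ((j : ℚ) + 1)) ^ 2 + a) * denWindow a x (j + 1)) := by
    have := mul_denProd a x (j + 1)
    push_cast at this
    rw [aperyTerm, this, ← mul_numProd]
    ring
  have e2 : aperyTerm a (x + 1) j =
      aperyCoeff a j * (5 * ((j : ℚ) + 1) ^ 2 - (x + 1) ^ 2 + a) * (x + 1) *
      ((x + j + 1) * numWindow x j) /
        (((x + ((j : ℚ) + 1) + 1) ^ 2 + a) * denWindow a x (j + 1)) := by
    have := add_one_mul_denProd a x (j + 1)
    push_cast at this
    rw [aperyTerm, this, ← add_one_mul_numProd]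
    ring
  have e3 : aperyMate a x (j + 1) =
      -((2 * x + 1) * (2 * (2 * (j : ℚ) + 3) * (((j : ℚ) + 1) ^ 2 + a) * aperyCoeff a j) *
        (numWindow x j * ((x - j) * (x + j + 1))) /
        (denWindow a x (j + 1) *
          (((x - ((j : ℚ) + 1)) ^ 2 + a) * ((x + ((j : ℚ) + 1) + 1) ^ 2 + a)))) := by
    rw [← aperyCoeff_succ, aperyMate, numWindow, denWindow, Finset.prod_range_succ,
      Finset.prod_range_succ _ (j + 1), ← numWindow, ← denWindow]
    push_cast
    ring
  rw [e1, e2, e3, aperyMate]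
  field_simp
  ring

theorem aperyMate_zero {a : ℚ} (ha : 0 < a) (x : ℚ) :
    aperyMate a x 0 = 2 / ((x + 1) ^ 2 + a) - 2 / (x ^ 2 + a) := by
  have h1 : x ^ 2 + a ≠ 0 := by positivity
  have h2 : (x + 1) ^ 2 + a ≠ 0 := by positivity
  simp only [aperyMate, aperyCoeff, numWindow, denWindow, Finset.prod_range_succ,
    Finset.prod_range_zero, zero_add, show Nat.centralBinom 1 = 2 from rfl]
  push_cast
  field_simp
  ring

theorem numWindow_eq_zero {n K : ℕ} (h : n < K) : numWindow n K = 0 :=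
  Finset.prod_eq_zero (Finset.mem_range.2 h) (by simp)

/-- The two-parameter identity. The companion vanishes at `j = K` when `n < K`, so a step from `n`
to `n + 1` changes the sum by the companion at `j = 0`, which is itself a difference in `n`. -/
theorem sum_aperyTerm {a : ℚ} (ha : 0 < a) (K n : ℕ) (h : n ≤ K) :
    ∑ j ∈ Finset.range K, aperyTerm a n j = 2 / a - 2 / ((n : ℚ) ^ 2 + a) := by
  induction n with
  | zero => simp [aperyTerm]
  | succ n ih =>
    have key := Finset.sum_range_sub (aperyMate a n) K
    have hK : aperyMate a n K = 0 := by simp [aperyMate, numWindow_eq_zero h]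
    rw [← Finset.sum_congr rfl fun j _ => aperyTerm_add_one_sub ha (n : ℚ) j,
      Finset.sum_sub_distrib, ih (by omega), hK, aperyMate_zero ha] at key
    push_cast
    linear_combination key

/-- The identity at `a = n²`, due to Almkvist and Granville, in which `denProd` becomes
`∏ (m⁴ + 4n⁴)`. -/
theorem sum_centralBinom_mul_prod_div {n : ℕ} (hn : 0 < n) :
    ∑ j ∈ Finset.range n, (5 / 2) * (Nat.centralBinom (j + 1) : ℚ) * ((j : ℚ) + 1) ^ 2 *
      (∏ i ∈ Finset.range j,
        ((n : ℚ) ^ 4 - ((i : ℚ) + 1) ^ 4) / (((i : ℚ) + 1) ^ 4 + 4 * (n : ℚ) ^ 4)) /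
      (((j : ℚ) + 1) ^ 4 + 4 * (n : ℚ) ^ 4) = 1 / (n : ℚ) ^ 2 := by
  have hn' : (0 : ℚ) < n := by exact_mod_cast hn
  have h := sum_aperyTerm (a := (n : ℚ) ^ 2) (by positivity) n n le_rfl
  rw [show 2 / (n : ℚ) ^ 2 - 2 / ((n : ℚ) ^ 2 + (n : ℚ) ^ 2) = 1 / (n : ℚ) ^ 2 by
    field_simp; norm_num] at h
  rw [← h]
  refine Finset.sum_congr rfl fun j _ => ?_
  have hden (i : ℕ) : ((i : ℚ) + 1) ^ 4 + 4 * (n : ℚ) ^ 4 =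
      (((i : ℚ) + 1 - n) ^ 2 + (n : ℚ) ^ 2) * (((i : ℚ) + 1 + n) ^ 2 + (n : ℚ) ^ 2) := by ring
  have hnum : ∏ i ∈ Finset.range j, ((n : ℚ) ^ 4 - ((i : ℚ) + 1) ^ 4) =
      numProd n j * ∏ i ∈ Finset.range j, (((i : ℚ) + 1) ^ 2 + (n : ℚ) ^ 2) := by
    rw [numProd, ← Finset.prod_mul_distrib]
    exact Finset.prod_congr rfl fun i _ => by ring
  have hd : denProd ((n : ℚ) ^ 2) n (j + 1) =
      (∏ i ∈ Finset.range j, (((i : ℚ) + 1) ^ 4 + 4 * (n : ℚ) ^ 4)) *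
        (((j : ℚ) + 1) ^ 4 + 4 * (n : ℚ) ^ 4) := by
    rw [denProd, ← Finset.prod_range_succ]
    exact Finset.prod_congr rfl fun i _ => (hden i).symm
  have hE : (∏ i ∈ Finset.range j, (((i : ℚ) + 1) ^ 4 + 4 * (n : ℚ) ^ 4)) ≠ 0 :=
    (Finset.prod_pos fun i _ => by positivity).ne'
  rw [aperyTerm, hd, Finset.prod_div_distrib, hnum, aperyCoeff]
  field_simp
  ring

/-! ### Rationals integral at a prime -/

/-- The local ring `ℤ_(p)`: the subring of rationals whose reduced denominator is prime to `p`. -/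
def pIntegral (p : ℕ) [hp : Fact p.Prime] : Subring ℚ where
  carrier := {x | ¬ p ∣ x.den}
  one_mem' := by simpa using hp.out.one_lt.ne'
  zero_mem' := by simpa using hp.out.one_lt.ne'
  neg_mem' := by simp
  add_mem' {x y} hx hy h :=
    ((hp.out.dvd_mul).1 (h.trans (Rat.add_den_dvd x y))).elim hx hy
  mul_mem' {x y} hx hy h :=
    ((hp.out.dvd_mul).1 (h.trans (Rat.mul_den_dvd x y))).elim hx hy

section

variable {p : ℕ} [hp : Fact p.Prime]

theorem mem_pIntegral {x : ℚ} : x ∈ pIntegral p ↔ ¬ p ∣ x.den := Iff.rfl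

theorem one_div_natCast_mem {k : ℕ} (hk : ¬ p ∣ k) : 1 / (k : ℚ) ∈ pIntegral p := by
  have h0 : 0 < k := Nat.pos_of_ne_zero fun h => hk (h ▸ dvd_zero p)
  rwa [mem_pIntegral, one_div, Rat.inv_natCast_den_of_pos h0]

theorem exists_eq_mul_of_dvd_num {x : ℚ} (hx : x ∈ pIntegral p) (h : (p : ℤ) ∣ x.num) :
    ∃ c ∈ pIntegral p, x = p * c := by
  obtain ⟨m, hm⟩ := h
  refine ⟨m * (1 / (x.den : ℚ)), mul_mem (intCast_mem _ m) (one_div_natCast_mem hx), ?_⟩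
  conv_lhs => rw [← Rat.num_div_den x, hm]
  push_cast
  ring

/-- An element of `ℤ_(p)` congruent modulo `p` to an integer prime to `p` is a unit. -/
theorem ne_zero_and_inv_mem_of_eq_add {x c : ℚ} {u : ℕ} (hu : ¬ p ∣ u) (hc : c ∈ pIntegral p)
    (hx : x = u + p * c) : x ≠ 0 ∧ x⁻¹ ∈ pIntegral p := by
  have hp0 : (p : ℚ) ≠ 0 := by exact_mod_cast hp.out.ne_zero
  have hxR : x ∈ pIntegral p :=
    hx ▸ add_mem (natCast_mem _ u) (mul_mem (natCast_mem _ p) hc)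
  have hnum : ¬ (p : ℤ) ∣ x.num := by
    intro h
    obtain ⟨d, hd, hxd⟩ := exists_eq_mul_of_dvd_num hxR h
    -- the integer `u` would be `p` times a `p`-integral rational
    have hu' : (u : ℚ) = p * (d - c) := by linear_combination hxd - hx
    have hmem : d - c ∈ pIntegral p := sub_mem hd hc
    apply hu
    have h1 : (u : ℚ) * (d - c).den = p * (d - c).num := by
      rw [hu', mul_assoc, Rat.mul_den_eq_num]
    have h2 : (p : ℤ) ∣ (u : ℤ) * (d - c).den := ⟨(d - c).num, by exact_mod_cast h1⟩
    have h3 : p ∣ u * (d - c).den := by exact_mod_cast h2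
    exact (hp.out.dvd_mul.1 h3).resolve_right hmem
  have hx0 : x ≠ 0 := by
    rintro rfl
    simp at hnum
  refine ⟨hx0, ?_⟩
  rw [mem_pIntegral, Rat.den_inv_of_ne_zero hx0]
  rwa [← Int.natCast_dvd]

/-- Expansion of a product of elements close to `1`, to first order. -/
theorem exists_prod_one_add_eq_first {ι : Type*} (s : Finset ι) {t : ℚ} {u : ι → ℚ}
    (ht : t ∈ pIntegral p) (hu : ∀ i ∈ s, u i ∈ pIntegral p) :
    ∃ c ∈ pIntegral p, ∏ i ∈ s, (1 + t * u i) = 1 + t * ∑ i ∈ s, u i + t ^ 2 * c := by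
  classical
  induction s using Finset.induction_on with
  | empty => exact ⟨0, zero_mem _, by simp⟩
  | insert a s ha ih =>
    obtain ⟨c, hc, h⟩ := ih fun i hi => hu i (Finset.mem_insert_of_mem hi)
    have hua := hu a (Finset.mem_insert_self a s)
    have hS := sum_mem fun i (hi : i ∈ s) => hu i (Finset.mem_insert_of_mem hi)
    refine ⟨c + u a * ∑ i ∈ s, u i + t * u a * c,
      add_mem (add_mem hc (mul_mem hua hS)) (mul_mem (mul_mem ht hua) hc), ?_⟩
    rw [Finset.prod_insert ha, Finset.sum_insert ha, h]
    ring

/-- Expansion of a product of elements close to `1`, to second order. The second elementary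
symmetric function is written in terms of power sums, whence the factor `2`. -/
theorem exists_prod_one_add_eq_second {ι : Type*} (s : Finset ι) {t : ℚ} {u : ι → ℚ}
    (ht : t ∈ pIntegral p) (hu : ∀ i ∈ s, u i ∈ pIntegral p) :
    ∃ c ∈ pIntegral p, 2 * ∏ i ∈ s, (1 + t * u i) =
      2 + 2 * t * ∑ i ∈ s, u i + t ^ 2 * ((∑ i ∈ s, u i) ^ 2 - ∑ i ∈ s, u i ^ 2) +
        t ^ 3 * c := by
  classical
  induction s using Finset.induction_on with
  | empty => exact ⟨0, zero_mem _, by simp⟩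
  | insert a s ha ih =>
    obtain ⟨c, hc, h⟩ := ih fun i hi => hu i (Finset.mem_insert_of_mem hi)
    have hua := hu a (Finset.mem_insert_self a s)
    have hS := sum_mem fun i (hi : i ∈ s) => hu i (Finset.mem_insert_of_mem hi)
    have hQ := sum_mem fun i (hi : i ∈ s) => pow_mem (hu i (Finset.mem_insert_of_mem hi)) 2
    refine ⟨c + u a * ((∑ i ∈ s, u i) ^ 2 - ∑ i ∈ s, u i ^ 2) + t * u a * c,
      add_mem (add_mem hc (mul_mem hua (sub_mem (pow_mem hS 2) hQ)))
        (mul_mem (mul_mem ht hua) hc), ?_⟩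
    rw [Finset.prod_insert ha, Finset.sum_insert ha, Finset.sum_insert ha, mul_left_comm, h]
    ring

/-! ### Harmonic sums and the central binomial coefficient -/

theorem harmonicSum_eq_sum_range (e n : ℕ) :
    harmonicSum e n = ∑ i ∈ Finset.range n, (1 / ((i : ℚ) + 1)) ^ e := by
  unfold harmonicSum
  induction n with
  | zero => simp
  | succ n ih =>
    rw [Finset.sum_Icc_succ_top (by omega), Finset.sum_range_succ, ih, one_div_pow]
    push_cast
    rfl

theorem one_div_add_one_mem {i : ℕ} (hi : i + 1 < p) : 1 / ((i : ℚ) + 1) ∈ pIntegral p := by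
  have := one_div_natCast_mem (p := p) (Nat.not_dvd_of_pos_of_lt i.succ_pos hi)
  simpa using this

theorem sum_range_inv_sq_zmod (hp3 : 3 < p) :
    ∑ i ∈ Finset.range (p - 1), (((i : ZMod p) + 1)⁻¹) ^ 2 = 0 := by
  have h0 : ∑ x : ZMod p, (x⁻¹) ^ 2 = 0 := by
    rw [← FiniteField.sum_pow_lt_card_sub_one (ZMod p) 2 (by rw [ZMod.card]; omega)]
    exact Equiv.sum_comp (Equiv.inv (ZMod p)) fun x => x ^ 2
  have h1 : ∑ i ∈ Finset.range (p - 1 + 1), ((i : ZMod p)⁻¹) ^ 2 = ∑ x : ZMod p, (x⁻¹) ^ 2 := by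
    rw [Nat.sub_add_cancel hp.out.one_le]
    refine Finset.sum_nbij' (fun i => (i : ZMod p)) ZMod.val (by simp)
      (fun x _ => Finset.mem_range.2 (ZMod.val_lt x))
      (fun i hi => ZMod.val_cast_of_lt (Finset.mem_range.1 hi)) (fun x _ => ZMod.natCast_zmod_val x)
      (fun _ _ => rfl)
  rw [h0, Finset.sum_range_succ'] at h1
  simpa using h1

/-- The sum of the inverse squares modulo `p` vanishes. -/
theorem exists_harmonicSum_two_eq (hp3 : 3 < p) :
    ∃ c ∈ pIntegral p, harmonicSum 2 (p - 1) = p * c := by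
  have hden {x : ℚ} (hx : x ∈ pIntegral p) : (x.den : ZMod p) ≠ 0 := by
    rwa [Ne, ZMod.natCast_eq_zero_iff]
  have hmem (m : ℕ) (hm : m ≤ p - 1) :
      ∑ i ∈ Finset.range m, (1 / ((i : ℚ) + 1)) ^ 2 ∈ pIntegral p :=
    sum_mem fun i hi => pow_mem (one_div_add_one_mem (by have := Finset.mem_range.1 hi; omega)) 2
  have key : ∀ m ≤ p - 1, ((∑ i ∈ Finset.range m, (1 / ((i : ℚ) + 1)) ^ 2 : ℚ) : ZMod p) =
      ∑ i ∈ Finset.range m, (((i : ZMod p) + 1)⁻¹) ^ 2 := by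
    intro m hm
    induction m with
    | zero => simp
    | succ m ih =>
      have hsq : (1 / ((m : ℚ) + 1)) ^ 2 = (((m + 1) ^ 2 : ℕ) : ℚ)⁻¹ := by
        push_cast
        rw [one_div, inv_pow]
      have hcast : (((1 / ((m : ℚ) + 1)) ^ 2 : ℚ) : ZMod p) = (((m : ZMod p) + 1)⁻¹) ^ 2 := by
        rw [hsq, Rat.cast_inv_nat]
        push_cast
        rw [inv_pow]
      rw [Finset.sum_range_succ, Finset.sum_range_succ, ← ih (by omega), ← hcast,
        Rat.cast_add_of_ne_zero]
      · exact hden (hmem m (by omega))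
      · exact hden (pow_mem (one_div_add_one_mem (by omega)) 2)
  have hcast := key _ le_rfl
  rw [sum_range_inv_sq_zmod hp3, ← harmonicSum_eq_sum_range, Rat.cast_def,
    div_eq_zero_iff] at hcast
  have hR : harmonicSum 2 (p - 1) ∈ pIntegral p := by
    rw [harmonicSum_eq_sum_range]
    exact hmem _ le_rfl
  exact exists_eq_mul_of_dvd_num hR
    ((ZMod.intCast_zmod_eq_zero_iff_dvd _ _).1 (hcast.resolve_right (hden hR)))

theorem centralBinom_eq_prod (n : ℕ) :
    (Nat.centralBinom n : ℚ) = ∏ i ∈ Finset.range n, (1 + n * (1 / ((i : ℚ) + 1))) := by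
  have key : ∀ j, ((n + j).choose j : ℚ) = ∏ i ∈ Finset.range j, (1 + n * (1 / ((i : ℚ) + 1))) := by
    intro j
    induction j with
    | zero => simp
    | succ j ih =>
      have h : ((n : ℚ) + j + 1) * ((n + j).choose j : ℚ) =
          ((n + (j + 1)).choose (j + 1) : ℚ) * ((j : ℚ) + 1) := by
        exact_mod_cast Nat.add_one_mul_choose_eq (n + j) j
      have hj : (j : ℚ) + 1 ≠ 0 := by positivity
      rw [Finset.prod_range_succ, ← ih]
      field_simp
      linear_combination -h
  rw [← key, Nat.centralBinom, two_mul]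

end

/-! ### Pairing `k` with `p - k` -/

/-- The rational `1 / (k (p - k))` with `k = i + 1`. -/
def pairInv (p i : ℕ) : ℚ := 1 / ((i : ℚ) + 1) * (1 / ((p : ℚ) - ((i : ℚ) + 1)))

section

variable {p : ℕ}

theorem cast_reflect {i : ℕ} (hi : i ∈ Finset.range (p - 1)) :
    ((p - 1 - 1 - i : ℕ) : ℚ) + 1 = (p : ℚ) - ((i : ℚ) + 1) := by
  have hi' := Finset.mem_range.1 hi
  have : (p - 1 - 1 - i) + 1 + (i + 1) = p := by omega
  rw [eq_sub_iff_add_eq]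
  exact_mod_cast this

theorem prod_reflect (f : ℚ → ℚ) :
    ∏ i ∈ Finset.range (p - 1), f ((p : ℚ) - ((i : ℚ) + 1)) =
      ∏ i ∈ Finset.range (p - 1), f ((i : ℚ) + 1) := by
  rw [← Finset.prod_range_reflect]
  exact Finset.prod_congr rfl fun i hi => by rw [cast_reflect hi, sub_sub_cancel]

theorem sum_reflect (f : ℚ → ℚ) :
    ∑ i ∈ Finset.range (p - 1), f ((p : ℚ) - ((i : ℚ) + 1)) =
      ∑ i ∈ Finset.range (p - 1), f ((i : ℚ) + 1) := by
  rw [← Finset.sum_range_reflect]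
  exact Finset.sum_congr rfl fun i hi => by rw [cast_reflect hi, sub_sub_cancel]

theorem two_mul_harmonicSum (e : ℕ) :
    2 * harmonicSum e (p - 1) = ∑ i ∈ Finset.range (p - 1),
      ((1 / ((i : ℚ) + 1)) ^ e + (1 / ((p : ℚ) - ((i : ℚ) + 1))) ^ e) := by
  rw [Finset.sum_add_distrib, sum_reflect fun x => (1 / x) ^ e, harmonicSum_eq_sum_range]
  ring

theorem sub_add_one_ne_zero {i : ℕ} (hi : i ∈ Finset.range (p - 1)) :
    (p : ℚ) - ((i : ℚ) + 1) ≠ 0 := by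
  rw [← cast_reflect hi]
  positivity

theorem inv_add_inv_reflect {i : ℕ} (hi : i ∈ Finset.range (p - 1)) :
    1 / ((i : ℚ) + 1) + 1 / ((p : ℚ) - ((i : ℚ) + 1)) = p * pairInv p i := by
  have h1 := sub_add_one_ne_zero hi
  have h2 : (i : ℚ) + 1 ≠ 0 := by positivity
  rw [pairInv]
  field_simp
  ring

theorem two_mul_harmonicSum_one :
    2 * harmonicSum 1 (p - 1) = p * ∑ i ∈ Finset.range (p - 1), pairInv p i := by
  rw [two_mul_harmonicSum, Finset.mul_sum]
  refine Finset.sum_congr rfl fun i hi => ?_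
  rw [pow_one, pow_one, inv_add_inv_reflect hi]

theorem two_mul_harmonicSum_two :
    2 * harmonicSum 2 (p - 1) = p ^ 2 * ∑ i ∈ Finset.range (p - 1), pairInv p i ^ 2 -
      2 * ∑ i ∈ Finset.range (p - 1), pairInv p i := by
  rw [two_mul_harmonicSum, Finset.mul_sum, Finset.mul_sum, ← Finset.sum_sub_distrib]
  refine Finset.sum_congr rfl fun i hi => ?_
  have h := inv_add_inv_reflect hi
  rw [← mul_pow, ← h, pairInv]
  ring

theorem two_mul_harmonicSum_three :
    2 * harmonicSum 3 (p - 1) = p ^ 3 * ∑ i ∈ Finset.range (p - 1), pairInv p i ^ 3 -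
      3 * p * ∑ i ∈ Finset.range (p - 1), pairInv p i ^ 2 := by
  rw [two_mul_harmonicSum, Finset.mul_sum, Finset.mul_sum, ← Finset.sum_sub_distrib]
  refine Finset.sum_congr rfl fun i hi => ?_
  have h := inv_add_inv_reflect hi
  rw [show (3 : ℚ) * p * pairInv p i ^ 2 = 3 * (p * pairInv p i) * pairInv p i by ring,
    ← mul_pow, ← h, pairInv]
  ring

theorem two_mul_harmonicSum_four :
    2 * harmonicSum 4 (p - 1) = 2 * ∑ i ∈ Finset.range (p - 1), pairInv p i ^ 2 +
      p ^ 2 * (p ^ 2 * ∑ i ∈ Finset.range (p - 1), pairInv p i ^ 4 -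
        4 * ∑ i ∈ Finset.range (p - 1), pairInv p i ^ 3) := by
  rw [two_mul_harmonicSum, Finset.mul_sum, Finset.mul_sum, Finset.mul_sum,
    ← Finset.sum_sub_distrib, Finset.mul_sum, ← Finset.sum_add_distrib]
  refine Finset.sum_congr rfl fun i hi => ?_
  have h := inv_add_inv_reflect hi
  rw [show 2 * pairInv p i ^ 2 + (p : ℚ) ^ 2 * (p ^ 2 * pairInv p i ^ 4 - 4 * pairInv p i ^ 3) =
    (p * pairInv p i) ^ 4 - 4 * (p * pairInv p i) ^ 2 * pairInv p i + 2 * pairInv p i ^ 2 by ring,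
    ← h, pairInv]
  ring

variable [hp : Fact p.Prime]

theorem pairInv_mem {i : ℕ} (hi : i ∈ Finset.range (p - 1)) : pairInv p i ∈ pIntegral p := by
  have hi' := Finset.mem_range.1 hi
  refine mul_mem (one_div_add_one_mem (by omega)) ?_
  rw [← cast_reflect hi]
  exact one_div_add_one_mem (by omega)

theorem sum_pairInv_pow_mem (e : ℕ) :
    ∑ i ∈ Finset.range (p - 1), pairInv p i ^ e ∈ pIntegral p :=
  sum_mem fun _ hi => pow_mem (pairInv_mem hi) e

theorem one_div_two_mem (hp3 : 3 < p) : (1 / 2 : ℚ) ∈ pIntegral p := by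
  have := one_div_natCast_mem (p := p) (Nat.not_dvd_of_pos_of_lt two_pos (by omega))
  simpa using this

/-- Wolstenholme's congruence: `∑ 1 / (k (p - k)) = 2 H(1) / p` is divisible by `p`. -/
theorem exists_sum_pairInv_eq (hp3 : 3 < p) :
    ∃ c ∈ pIntegral p, ∑ i ∈ Finset.range (p - 1), pairInv p i = p * c := by
  obtain ⟨h, hh, hH⟩ := exists_harmonicSum_two_eq hp3
  have h2 := two_mul_harmonicSum_two (p := p)
  refine ⟨1 / 2 * (p * ∑ i ∈ Finset.range (p - 1), pairInv p i ^ 2) - h,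
    sub_mem (mul_mem (one_div_two_mem hp3) (mul_mem (natCast_mem _ p) (sum_pairInv_pow_mem 2))) hh,
    ?_⟩
  linear_combination (1 / 2) * h2 - hH

theorem exists_harmonicSum_four_eq (hp3 : 3 < p) :
    ∃ c ∈ pIntegral p, harmonicSum 4 (p - 1) =
      ∑ i ∈ Finset.range (p - 1), pairInv p i ^ 2 + p ^ 2 * c := by
  have hpR : (p : ℚ) ∈ pIntegral p := natCast_mem _ p
  refine ⟨1 / 2 * (p ^ 2 * ∑ i ∈ Finset.range (p - 1), pairInv p i ^ 4 -
        4 * ∑ i ∈ Finset.range (p - 1), pairInv p i ^ 3),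
    mul_mem (one_div_two_mem hp3) (sub_mem (mul_mem (pow_mem hpR 2) (sum_pairInv_pow_mem 4))
      (mul_mem (ofNat_mem _ 4) (sum_pairInv_pow_mem 3))), ?_⟩
  linear_combination (1 / 2) * two_mul_harmonicSum_four (p := p)

/-! ### The central binomial coefficient modulo `p ^ 6` -/

/-- The product `∏_{k<p} (1 + p/k)`, that is, `binom(2p, p) / 2`, modulo `p ^ 6`. Its square is
`∏ (1 + 2 p² / (k (p - k)))`, which is expanded to second order; the square root can be compared
because the product is `1` modulo `p`. -/
theorem exists_prod_one_add_div_eq (hp3 : 3 < p) :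
    ∃ c ∈ pIntegral p, ∏ i ∈ Finset.range (p - 1), (1 + (p : ℚ) * (1 / ((i : ℚ) + 1))) =
      1 + p ^ 2 * ∑ i ∈ Finset.range (p - 1), pairInv p i -
        p ^ 4 * ∑ i ∈ Finset.range (p - 1), pairInv p i ^ 2 + p ^ 6 * c := by
  have hpR : (p : ℚ) ∈ pIntegral p := natCast_mem _ p
  have h2R : (2 : ℚ) ∈ pIntegral p := ofNat_mem _ 2
  set C := ∏ i ∈ Finset.range (p - 1), (1 + (p : ℚ) * (1 / ((i : ℚ) + 1))) with hC
  have hQR := sum_pairInv_pow_mem (p := p) 2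
  set Q := ∑ i ∈ Finset.range (p - 1), pairInv p i ^ 2 with hQ
  have hmem : ∀ i ∈ Finset.range (p - 1), 1 / ((i : ℚ) + 1) ∈ pIntegral p := fun i hi =>
    one_div_add_one_mem (by have := Finset.mem_range.1 hi; omega)
  obtain ⟨c₁, hc₁, h₁⟩ := exists_prod_one_add_eq_first _ hpR hmem
  have hHR := sum_mem hmem
  have hsq : C ^ 2 = ∏ i ∈ Finset.range (p - 1), (1 + 2 * (p : ℚ) ^ 2 * pairInv p i) := by
    rw [sq]
    nth_rewrite 2 [hC]
    rw [← prod_reflect fun x => 1 + (p : ℚ) * (1 / x), hC, ← Finset.prod_mul_distrib]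
    refine Finset.prod_congr rfl fun i hi => ?_
    have h := inv_add_inv_reflect hi
    rw [pairInv] at h ⊢
    linear_combination (p : ℚ) * h
  obtain ⟨c₂, hc₂, h₂⟩ := exists_prod_one_add_eq_second (Finset.range (p - 1))
    (mul_mem h2R (pow_mem hpR 2)) fun i hi => pairInv_mem hi
  rw [← hsq, ← hQ] at h₂
  obtain ⟨s, hs, hS⟩ := exists_sum_pairInv_eq hp3
  rw [hS] at h₂ ⊢
  set X := 1 + (p : ℚ) ^ 2 * (p * s) - p ^ 4 * Q with hX
  obtain ⟨hne, hunit⟩ : C + X ≠ 0 ∧ (C + X)⁻¹ ∈ pIntegral p := by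
    refine ne_zero_and_inv_mem_of_eq_add (u := 2) (c := ∑ i ∈ Finset.range (p - 1), 1 / ((i : ℚ) + 1) +
      p * c₁ + p * (p * s) - p ^ 3 * Q) (Nat.not_dvd_of_pos_of_lt two_pos (by omega)) ?_ ?_
    · exact sub_mem (add_mem (add_mem hHR (mul_mem hpR hc₁)) (mul_mem hpR (mul_mem hpR hs)))
        (mul_mem (pow_mem hpR 3) hQR)
    · push_cast
      rw [hX]
      linear_combination h₁
  refine ⟨(2 * s ^ 2 + 4 * c₂ - (s - p * Q) ^ 2) * (C + X)⁻¹, mul_mem (sub_mem (add_mem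
    (mul_mem h2R (pow_mem hs 2)) (mul_mem (ofNat_mem _ 4) hc₂))
      (pow_mem (sub_mem hs (mul_mem hpR hQR)) 2)) hunit, ?_⟩
  have key : (C - X) * (C + X) = p ^ 6 * (2 * s ^ 2 + 4 * c₂ - (s - p * Q) ^ 2) := by
    rw [hX]
    linear_combination (1 / 2) * h₂
  have : C - X = p ^ 6 * (2 * s ^ 2 + 4 * c₂ - (s - p * Q) ^ 2) * (C + X)⁻¹ := by
    rw [← key, mul_assoc, mul_inv_cancel₀ hne, mul_one]
  linear_combination this

theorem exists_centralBinom_eq (hp3 : 3 < p) :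
    ∃ c ∈ pIntegral p, (Nat.centralBinom p : ℚ) =
      2 * (1 + p ^ 2 * ∑ i ∈ Finset.range (p - 1), pairInv p i -
        p ^ 4 * ∑ i ∈ Finset.range (p - 1), pairInv p i ^ 2 + p ^ 6 * c) := by
  obtain ⟨c, hc, h⟩ := exists_prod_one_add_div_eq hp3
  refine ⟨c, hc, ?_⟩
  have hp0 : (p : ℚ) ≠ 0 := by exact_mod_cast hp.out.ne_zero
  have hlast : ((p - 1 : ℕ) : ℚ) + 1 = p := by exact_mod_cast Nat.sub_add_cancel hp.out.one_le
  have hsplit := Finset.prod_range_succ (fun i : ℕ => 1 + (p : ℚ) * (1 / ((i : ℚ) + 1))) (p - 1)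
  rw [Nat.sub_add_cancel hp.out.one_le, h, hlast, mul_one_div_cancel hp0] at hsplit
  rw [centralBinom_eq_prod, hsplit]
  ring

end

/-! ### Reduction of the finite identity modulo `p ^ 4` -/

section

variable {p : ℕ}

/-- Each quotient `(p⁴ - m⁴) / (m⁴ + 4p⁴)` is `-(1 - 5p⁴ / (m⁴ + 4p⁴))`. -/
theorem prod_quotient_eq (n : ℕ) :
    ∏ i ∈ Finset.range n,
      ((p : ℚ) ^ 4 - ((i : ℚ) + 1) ^ 4) / (((i : ℚ) + 1) ^ 4 + 4 * (p : ℚ) ^ 4) =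
    (-1) ^ n * ∏ i ∈ Finset.range n,
      (1 + (p : ℚ) ^ 4 * (-5 * (1 / (((i : ℚ) + 1) ^ 4 + 4 * (p : ℚ) ^ 4)))) := by
  rw [← Finset.card_range n, ← Finset.prod_const, Finset.card_range, ← Finset.prod_mul_distrib]
  refine Finset.prod_congr rfl fun i _ => ?_
  have : ((i : ℚ) + 1) ^ 4 + 4 * (p : ℚ) ^ 4 ≠ 0 := by positivity
  field_simp
  ring

theorem one_div_quartic_eq (i : ℕ) :
    1 / (((i : ℚ) + 1) ^ 4 + 4 * (p : ℚ) ^ 4) = (1 / ((i : ℚ) + 1)) ^ 4 +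
      p ^ 4 * (-4 * (1 / ((i : ℚ) + 1)) ^ 4 * (1 / (((i : ℚ) + 1) ^ 4 + 4 * (p : ℚ) ^ 4))) := by
  have h1 : ((i : ℚ) + 1) ^ 4 + 4 * (p : ℚ) ^ 4 ≠ 0 := by positivity
  have h2 : (i : ℚ) + 1 ≠ 0 := by positivity
  field_simp
  ring

variable [hp : Fact p.Prime]

theorem one_div_quartic_mem {i : ℕ} (hi : i + 1 < p) :
    1 / (((i : ℚ) + 1) ^ 4 + 4 * (p : ℚ) ^ 4) ∈ pIntegral p := by
  have hnd : ¬ p ∣ (i + 1) ^ 4 + 4 * p ^ 4 := by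
    rw [Nat.dvd_add_left ((dvd_pow_self p four_ne_zero).mul_left 4)]
    exact fun h => Nat.not_dvd_of_pos_of_lt i.succ_pos hi (hp.out.dvd_of_dvd_pow h)
  simpa using one_div_natCast_mem hnd

/-- The terms with `k < p` of the finite identity reduce to those of the alternating sum. -/
theorem exists_term_eq {j : ℕ} (hj : j + 1 < p) :
    ∃ c ∈ pIntegral p, (Nat.centralBinom (j + 1) : ℚ) * ((j : ℚ) + 1) ^ 2 *
      (∏ i ∈ Finset.range j,
        ((p : ℚ) ^ 4 - ((i : ℚ) + 1) ^ 4) / (((i : ℚ) + 1) ^ 4 + 4 * (p : ℚ) ^ 4)) /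
      (((j : ℚ) + 1) ^ 4 + 4 * (p : ℚ) ^ 4) =
    -((-1) ^ (j + 1) / ((j : ℚ) + 1) ^ 2 * (Nat.centralBinom (j + 1) : ℚ)) + p ^ 4 * c := by
  have hpR : (p : ℚ) ∈ pIntegral p := natCast_mem _ p
  have hbR : (Nat.centralBinom (j + 1) : ℚ) ∈ pIntegral p := natCast_mem _ _
  have hkR : (j : ℚ) + 1 ∈ pIntegral p := add_mem (natCast_mem _ j) (one_mem _)
  have hsR : ((-1 : ℚ)) ^ j ∈ pIntegral p := pow_mem (neg_mem (one_mem _)) j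
  have hdR := one_div_quartic_mem hj
  have hiR := one_div_add_one_mem hj
  have h4R : (-4 : ℚ) ∈ pIntegral p := neg_mem (ofNat_mem _ 4)
  have hmem : ∀ i ∈ Finset.range j,
      -5 * (1 / (((i : ℚ) + 1) ^ 4 + 4 * (p : ℚ) ^ 4)) ∈ pIntegral p := fun i hi =>
    mul_mem (neg_mem (ofNat_mem _ 5))
      (one_div_quartic_mem (by have := Finset.mem_range.1 hi; omega))
  obtain ⟨c, hc, h⟩ := exists_prod_one_add_eq_first _ (pow_mem hpR 4) hmem
  have hSR := sum_mem hmem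
  rw [prod_quotient_eq, h]
  generalize ∑ i ∈ Finset.range j, -5 * (1 / (((i : ℚ) + 1) ^ 4 + 4 * (p : ℚ) ^ 4)) = S at hSR ⊢
  have hd := one_div_quartic_eq (p := p) j
  have hk : ((j : ℚ) + 1) ≠ 0 := by positivity
  refine ⟨(Nat.centralBinom (j + 1) : ℚ) * (-1) ^ j * ((j : ℚ) + 1) ^ 2 *
    ((S + p ^ 4 * c) * (1 / (((j : ℚ) + 1) ^ 4 + 4 * (p : ℚ) ^ 4)) +
      -4 * (1 / ((j : ℚ) + 1)) ^ 4 * (1 / (((j : ℚ) + 1) ^ 4 + 4 * (p : ℚ) ^ 4))),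
    mul_mem (mul_mem (mul_mem hbR hsR) (pow_mem hkR 2))
      (add_mem (mul_mem (add_mem hSR (mul_mem (pow_mem hpR 4) hc)) hdR)
        (mul_mem (mul_mem h4R (pow_mem hiR 4)) hdR)), ?_⟩
  have hsq : (-1 : ℚ) ^ j / ((j : ℚ) + 1) ^ 2 =
      (-1) ^ j * ((j : ℚ) + 1) ^ 2 * (1 / ((j : ℚ) + 1)) ^ 4 := by
    field_simp
  rw [pow_succ (-1 : ℚ) j, mul_neg_one, neg_div, hsq, div_eq_mul_one_div]
  linear_combination (Nat.centralBinom (j + 1) : ℚ) * (-1) ^ j * ((j : ℚ) + 1) ^ 2 * hd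

/-- The product occurring in the term `k = p` of the finite identity. The exponent `p - 1` is
even, so the sign disappears. -/
theorem exists_prod_quotient_eq (hp3 : 3 < p) :
    ∃ c ∈ pIntegral p, ∏ i ∈ Finset.range (p - 1),
      ((p : ℚ) ^ 4 - ((i : ℚ) + 1) ^ 4) / (((i : ℚ) + 1) ^ 4 + 4 * (p : ℚ) ^ 4) =
    1 - 5 * p ^ 4 * ∑ i ∈ Finset.range (p - 1), pairInv p i ^ 2 + p ^ 6 * c := by
  have hpR : (p : ℚ) ∈ pIntegral p := natCast_mem _ p
  have h4R : (-4 : ℚ) ∈ pIntegral p := neg_mem (ofNat_mem _ 4)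
  have h5R : (-5 : ℚ) ∈ pIntegral p := neg_mem (ofNat_mem _ 5)
  have hdR : ∀ i ∈ Finset.range (p - 1),
      1 / (((i : ℚ) + 1) ^ 4 + 4 * (p : ℚ) ^ 4) ∈ pIntegral p := fun i hi =>
    one_div_quartic_mem (by have := Finset.mem_range.1 hi; omega)
  obtain ⟨c, hc, h⟩ := exists_prod_one_add_eq_first _ (pow_mem hpR 4)
    fun i hi => mul_mem h5R (hdR i hi)
  obtain ⟨e, he, h4⟩ := exists_harmonicSum_four_eq (p := p) hp3
  have hdiff : ∃ d ∈ pIntegral p, ∑ i ∈ Finset.range (p - 1),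
      1 / (((i : ℚ) + 1) ^ 4 + 4 * (p : ℚ) ^ 4) = harmonicSum 4 (p - 1) + p ^ 4 * d := by
    refine ⟨∑ i ∈ Finset.range (p - 1), -4 * (1 / ((i : ℚ) + 1)) ^ 4 *
      (1 / (((i : ℚ) + 1) ^ 4 + 4 * (p : ℚ) ^ 4)), sum_mem fun i hi => mul_mem (mul_mem h4R
        (pow_mem (one_div_add_one_mem (by have := Finset.mem_range.1 hi; omega)) 4)) (hdR i hi), ?_⟩
    rw [harmonicSum_eq_sum_range, Finset.mul_sum, ← Finset.sum_add_distrib]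
    exact Finset.sum_congr rfl fun i _ => one_div_quartic_eq i
  obtain ⟨d, hd, hD⟩ := hdiff
  rw [prod_quotient_eq, h, (hp.out.even_sub_one (by omega)).neg_one_pow, ← Finset.mul_sum, hD, h4]
  refine ⟨-5 * (e + p ^ 2 * d) + p ^ 2 * c, add_mem (mul_mem h5R (add_mem he
    (mul_mem (pow_mem hpR 2) hd))) (mul_mem (pow_mem hpR 2) hc), ?_⟩
  ring

end

theorem theorem4p2 (p : ℕ) (hp : p.Prime) (hp5 : 5 < p) :
    RatModEq p 4
      (∑ k ∈ Finset.Icc 1 (p - 1), (-1 : ℚ) ^ k / (k : ℚ) ^ 2 * (Nat.choose (2 * k) k : ℚ))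
      (4 / 5 * (harmonicSum 1 (p - 1) / (p : ℚ) + 2 * (p : ℚ) * harmonicSum 3 (p - 1))) := by
  have : Fact p.Prime := ⟨hp⟩
  have hp3 : 3 < p := by omega
  have hp0 : (p : ℚ) ≠ 0 := by exact_mod_cast hp.ne_zero
  have hpR : (p : ℚ) ∈ pIntegral p := natCast_mem _ p
  have hlast : ((p - 1 : ℕ) : ℚ) + 1 = p := by exact_mod_cast Nat.sub_add_cancel hp.one_le
  have hT : ∑ k ∈ Finset.Icc 1 (p - 1), (-1 : ℚ) ^ k / (k : ℚ) ^ 2 * (Nat.choose (2 * k) k : ℚ) =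
      ∑ j ∈ Finset.range (p - 1),
        (-1 : ℚ) ^ (j + 1) / ((j : ℚ) + 1) ^ 2 * (Nat.centralBinom (j + 1) : ℚ) := by
    generalize p - 1 = n
    induction n with
    | zero => simp
    | succ n ih =>
      rw [Finset.sum_Icc_succ_top (by omega), Finset.sum_range_succ, ih]
      push_cast
      rfl
  rw [hT]
  set T := ∑ j ∈ Finset.range (p - 1),
    (-1 : ℚ) ^ (j + 1) / ((j : ℚ) + 1) ^ 2 * (Nat.centralBinom (j + 1) : ℚ) with hTdef
  have hterm : ∀ j : ℕ, ∃ c ∈ pIntegral p, j ∈ Finset.range (p - 1) →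
      (Nat.centralBinom (j + 1) : ℚ) * ((j : ℚ) + 1) ^ 2 *
      (∏ i ∈ Finset.range j,
        ((p : ℚ) ^ 4 - ((i : ℚ) + 1) ^ 4) / (((i : ℚ) + 1) ^ 4 + 4 * (p : ℚ) ^ 4)) /
      (((j : ℚ) + 1) ^ 4 + 4 * (p : ℚ) ^ 4) =
      -((-1) ^ (j + 1) / ((j : ℚ) + 1) ^ 2 * (Nat.centralBinom (j + 1) : ℚ)) + p ^ 4 * c := by
    intro j
    by_cases hj : j + 1 < p
    · obtain ⟨c, hc, h⟩ := exists_term_eq hj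
      exact ⟨c, hc, fun _ => h⟩
    · exact ⟨0, zero_mem _, fun h => absurd (Finset.mem_range.1 h) (by omega)⟩
  choose c hcR hc using hterm
  have hmain := sum_centralBinom_mul_prod_div hp.pos
  -- the term `k = p` has denominator `5p⁴` and is `p⁻² binom(2p, p) / 2` times the product
  have hsplit := Finset.sum_range_succ (fun j : ℕ => (5 / 2) * (Nat.centralBinom (j + 1) : ℚ) *
    ((j : ℚ) + 1) ^ 2 * (∏ i ∈ Finset.range j,
        ((p : ℚ) ^ 4 - ((i : ℚ) + 1) ^ 4) / (((i : ℚ) + 1) ^ 4 + 4 * (p : ℚ) ^ 4)) /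
      (((j : ℚ) + 1) ^ 4 + 4 * (p : ℚ) ^ 4)) (p - 1)
  have hhead : ∑ j ∈ Finset.range (p - 1), (5 / 2) * (Nat.centralBinom (j + 1) : ℚ) *
      ((j : ℚ) + 1) ^ 2 * (∏ i ∈ Finset.range j,
        ((p : ℚ) ^ 4 - ((i : ℚ) + 1) ^ 4) / (((i : ℚ) + 1) ^ 4 + 4 * (p : ℚ) ^ 4)) /
      (((j : ℚ) + 1) ^ 4 + 4 * (p : ℚ) ^ 4) =
      5 / 2 * (-T + p ^ 4 * ∑ j ∈ Finset.range (p - 1), c j) := by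
    rw [hTdef, Finset.mul_sum, ← Finset.sum_neg_distrib, ← Finset.sum_add_distrib, Finset.mul_sum]
    refine Finset.sum_congr rfl fun j hj => ?_
    rw [← hc j hj]
    ring
  have hcsum : ∑ j ∈ Finset.range (p - 1), c j ∈ pIntegral p := sum_mem fun j _ => hcR j
  generalize ∑ j ∈ Finset.range (p - 1), c j = c₀ at hhead hcsum
  obtain ⟨d, hd, hD⟩ := exists_centralBinom_eq (p := p) hp3
  obtain ⟨e, he, hE⟩ := exists_prod_quotient_eq (p := p) hp3
  obtain ⟨s, hs, hS⟩ := exists_sum_pairInv_eq (p := p) hp3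
  have hH1 := two_mul_harmonicSum_one (p := p)
  have hH3 := two_mul_harmonicSum_three (p := p)
  rw [Nat.sub_add_cancel hp.one_le, hmain, hhead, hlast, hD, hE, hS] at hsplit
  rw [hS] at hH1
  have hQR := sum_pairInv_pow_mem (p := p) 2
  have hUR := sum_pairInv_pow_mem (p := p) 3
  generalize ∑ i ∈ Finset.range (p - 1), pairInv p i ^ 2 = Q at hsplit hH3 hQR
  generalize ∑ i ∈ Finset.range (p - 1), pairInv p i ^ 3 = U at hH3 hUR
  have h5 : 1 / 5 ∈ pIntegral p := by
    have := one_div_natCast_mem (p := p) (Nat.not_dvd_of_pos_of_lt (by norm_num) hp5)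
    simpa using this
  have hT' : T = c₀ * p ^ 4 + 2 / 5 *
      (((1 + p ^ 3 * s - p ^ 4 * Q + p ^ 6 * d) * (1 - 5 * p ^ 4 * Q + p ^ 6 * e) - 1) / p ^ 2) := by
    field_simp at hsplit ⊢
    linear_combination (1 / 5) * hsplit
  have hR : 4 / 5 * (harmonicSum 1 (p - 1) / (p : ℚ) + 2 * (p : ℚ) * harmonicSum 3 (p - 1)) =
      2 / 5 * (p * s) + 4 / 5 * p * (p ^ 3 * U - 3 * p * Q) := by
    have : harmonicSum 1 (p - 1) / (p : ℚ) = p * s / 2 := by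
      field_simp
      linear_combination hH1
    rw [this]
    linear_combination 4 / 5 * p * hH3
  refine ⟨c₀ + 1 / 5 * (2 * (d + e + p * (s - p * Q + p ^ 3 * d) * (-5 * Q + p ^ 2 * e)) - 4 * U),
    ?_, ?_⟩
  · have h2 : (2 : ℚ) ∈ pIntegral p := ofNat_mem _ 2
    have h4 : (4 : ℚ) ∈ pIntegral p := ofNat_mem _ 4
    have hn5 : (-5 : ℚ) ∈ pIntegral p := neg_mem (ofNat_mem _ 5)
    exact add_mem hcsum (mul_mem h5 (sub_mem (mul_mem h2 (add_mem (add_mem hd he)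
      (mul_mem (mul_mem hpR (add_mem (sub_mem hs (mul_mem hpR hQR)) (mul_mem (pow_mem hpR 3) hd)))
        (add_mem (mul_mem hn5 hQR) (mul_mem (pow_mem hpR 2) he))))) (mul_mem h4 hUR)))
  · rw [hR, hT']
    field_simp
    ring
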